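/- Let $K$ be a field of characteristic $2$, let $\alpha \in K\setminus\{0\}$, let $E$ be a finite-dimensional $K$-vector space and let $u \in \mathrm{End}(E)$. Call $u$ an $(\alpha,\beta)$-composite if $u=\alpha p+\beta q$ for some idempotents $p,q\in \mathrm{End}(E)$. Write the minimal polynomial of $u$ as $\mu_u=PQ$, where $P$ is a monic product of linear factors $X-\lambda$ with $\lambda\in\{0,\alpha\}$ and $Q$ is monic with no root in $\{0,\alpha\}$, and let $u_{-\{0,\alpha\}}$ be the restriction of $u$ to the $u$-stable subspace $\ker Q(u)$. The elementary factors of an endomorphism $v$ are its nonconstant invariant factors, i.e. the (unique) nonconstant monic polynomials $P_1\mid P_2\mid\dots\mid P_N$ such that $v$ is represented in some basis by the block-diagonal matrix of the companion matrices of $P_1,\dots,P_N$. Then $u$ is an $(\alpha,-\alpha)$-composite (equivalently, an $(\alpha,\alpha)$-composite) if and only if every elementary factor of $u_{-\{0,\alpha\}}$ is an even polynomial, i.e. a polynomial of $X^2$. -/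

import Mathlib

open Polynomial

/-- An element `x` of a `K`-algebra is an `(α, β)`-composite when `x = α • p + β • q` for some
idempotents `p` and `q` of that algebra. -/
def IsComposite {K A : Type*} [Field K] [Ring A] [Algebra K A] (α β : K) (x : A) : Prop :=
  ∃ p q : A, IsIdempotentElem p ∧ IsIdempotentElem q ∧ x = α • p + β • q

section Parts

variable {K E : Type*} [Field K] [AddCommGroup E] [Module K E]

open Classical in
/-- The monic factor of the minimal polynomial of `u` that collects its roots lying in `Λ`
(with multiplicity). It splits over `K` and all its roots are in `Λ`. -/
noncomputable def insidePoly (u : Module.End K E) (Λ : Set K) : K[X] :=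
  (((minpoly K u).roots.filter (fun a => a ∈ Λ)).map (fun a => X - C a)).prod

/-- The complementary factor of the minimal polynomial of `u`, so that
`minpoly K u = insidePoly u Λ * outsidePoly u Λ`. -/
noncomputable def outsidePoly (u : Module.End K E) (Λ : Set K) : K[X] :=
  minpoly K u /ₘ insidePoly u Λ

theorem insidePoly_monic (u : Module.End K E) (Λ : Set K) : (insidePoly u Λ).Monic :=
  monic_multiset_prod_of_monic _ _ fun a _ => monic_X_sub_C a

theorem insidePoly_mul_outsidePoly (u : Module.End K E) (Λ : Set K) :
    insidePoly u Λ * outsidePoly u Λ = minpoly K u := by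
  classical
  have hd : insidePoly u Λ ∣ minpoly K u := by
    refine dvd_trans (Multiset.prod_dvd_prod_of_le (Multiset.map_le_map ?_))
      (prod_multiset_X_sub_C_dvd (minpoly K u))
    exact Multiset.filter_le _ _
  have h := modByMonic_add_div (minpoly K u) (insidePoly u Λ)
  rwa [(modByMonic_eq_zero_iff_dvd (insidePoly_monic u Λ)).2 hd, zero_add] at h

theorem outsidePoly_not_isRoot [FiniteDimensional K E] (u : Module.End K E) (Λ : Set K)
    (a : K) (ha : a ∈ Λ) : ¬ (outsidePoly u Λ).IsRoot a := by
  classical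
  intro hr
  have h0 : minpoly K u ≠ 0 := minpoly.ne_zero (Algebra.IsIntegral.isIntegral u)
  have hm := insidePoly_mul_outsidePoly u Λ
  have hne : insidePoly u Λ * outsidePoly u Λ ≠ 0 := by rwa [hm]
  have hc := congrArg (Multiset.count a) (roots_mul hne)
  have hin : (insidePoly u Λ).roots = (minpoly K u).roots.filter (fun b => b ∈ Λ) := by
    rw [insidePoly, roots_multiset_prod_X_sub_C]
  rw [hm, Multiset.count_add, hin, Multiset.count_filter_of_pos ha] at hc
  have hpos : 0 < Multiset.count a (outsidePoly u Λ).roots :=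
    Multiset.count_pos.2 ((mem_roots (right_ne_zero_of_mul hne)).2 hr)
  omega

/-- The subspace `Ker Q(u)`, where `Q = outsidePoly u Λ`. -/
noncomputable def outsideSpace (u : Module.End K E) (Λ : Set K) : Submodule K E :=
  LinearMap.ker (aeval u (outsidePoly u Λ))

theorem outsideSpace_invariant (u : Module.End K E) (Λ : Set K) :
    ∀ x ∈ outsideSpace u Λ, u x ∈ outsideSpace u Λ := by
  intro x hx
  have hx' : aeval u (outsidePoly u Λ) x = 0 := hx
  have hc : aeval u (outsidePoly u Λ) * u = u * aeval u (outsidePoly u Λ) := by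
    have h := congrArg (aeval u) (mul_comm (outsidePoly u Λ) X)
    simpa only [map_mul, aeval_X] using h
  have h := LinearMap.congr_fun hc x
  change aeval u (outsidePoly u Λ) (u x) = 0
  simpa [Module.End.mul_apply, hx'] using h

/-- The endomorphism `u_{-Λ}`: the restriction of `u` to `Ker Q(u)`, where `Q = outsidePoly u Λ`. -/
noncomputable def outsidePart (u : Module.End K E) (Λ : Set K) :
    Module.End K (outsideSpace u Λ) :=
  u.restrict (outsideSpace_invariant u Λ)

/-- `L = [P₁, …, P_N]` is the list of elementary factors (i.e. nonconstant invariant factors,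
or similarity invariants) of `v`: the `Pᵢ` are monic and nonconstant, each divides the next one,
and the `K[X]`-module in which `X` acts on the underlying space by `v` is isomorphic to
`K[X]/(P₁) × ⋯ × K[X]/(P_N)`; in other words, `v` is represented in some basis by the
block-diagonal matrix whose blocks are the companion matrices of `P₁, …, P_N`. -/
def IsElementaryFactors (v : Module.End K E) (L : List K[X]) : Prop :=
  (∀ P ∈ L, P.Monic ∧ 0 < P.natDegree) ∧
  L.IsChain (fun P Q => P ∣ Q) ∧
  Nonempty (Module.AEval' v ≃ₗ[K[X]] (∀ i : Fin L.length, K[X] ⧸ Ideal.span {L.get i}))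

end Parts

/-- A polynomial is even when it is a polynomial of `X ^ 2`. -/
def IsEvenPoly {K : Type*} [Field K] (P : K[X]) : Prop :=
  ∃ Q : K[X], P = Q.comp (X ^ 2)

/-! Put `w = X (X + α)`. If `x = αp + αq`, then `s = αp` satisfies `s² = αs`, and the idempotence of
`q` becomes `s x = x s + w(x)` in characteristic two. Thus commuting with `s` acts on polynomials in
`x` as the derivation `w d/dX` (`skew_smul`). Compressing `s` to a cyclic summand `K[X]/(P)` keeps
this relation; since `P` kills the summand, `P ∣ w P'` (`dvd_mul_derivative_of_skew`). Conversely,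
if `P ∣ w P'`, the operator `α + w d/dX` descends to `K[X]/(P)` and has the required square
(`exists_skew_quotient`). So composites are detected by `P ∣ w P'` on cyclic summands. On the part
of `u` with eigenvalues in `{0, α}`, `P` is a product of factors `X - a` dividing `w`, so the
condition is automatic. On the complementary part `P` is coprime to `w`, so `P ∣ P'`, which by
degree forces `P' = 0`, that is, `P` even. -/

section Composite

variable {K : Type*} [Field K]

/-- Algebra homomorphisms send composites to composites. -/
theorem IsComposite.map {A B : Type*} [Ring A] [Algebra K A] [Ring B] [Algebra K B]
    {α β : K} {x : A} (h : IsComposite α β x) (f : A →ₐ[K] B) : IsComposite α β (f x) := by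
  obtain ⟨p, q, hp, hq, rfl⟩ := h
  exact ⟨f p, f q, hp.map f, hq.map f, by simp⟩

/-- A pair of composites is a composite of the product algebra. -/
theorem IsComposite.prodMk {A B : Type*} [Ring A] [Algebra K A] [Ring B] [Algebra K B]
    {α β : K} {x : A} {y : B} (hx : IsComposite α β x) (hy : IsComposite α β y) :
    IsComposite α β (x, y) := by
  obtain ⟨p, q, hp, hq, rfl⟩ := hx
  obtain ⟨p', q', hp', hq', rfl⟩ := hy
  exact ⟨(p, p'), (q, q'), Prod.ext hp hp', Prod.ext hq hq', rfl⟩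

/-- In characteristic two, `(α, α)`-composites are the elements `x` for which some `s` with
`s * s = α • s` satisfies a skew commutation relation with `x`. -/
theorem isComposite_iff_exists_skew [CharP K 2] {A : Type*} [Ring A] [Algebra K A] {α : K}
    (hα : α ≠ 0) {x : A} :
    IsComposite α α x ↔ ∃ s : A, s * s = α • s ∧ s * x = x * s + (x * x + α • x) := by
  have two (a : A) : a + a = 0 := by
    rw [← two_smul K a, CharTwo.two_eq_zero, zero_smul]
  have neg (a : A) : -a = a := neg_eq_of_add_eq_zero_left (two a)
  constructor
  · rintro ⟨p, q, hp, hq, rfl⟩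
    have hp : p * p = p := hp
    have hq : q * q = q := hq
    refine ⟨α • p, by simp [hp], ?_⟩
    simp only [mul_add, add_mul, smul_mul_assoc, mul_smul_comm, hp, hq, smul_smul, smul_add]
    rw [← sub_eq_zero]
    have h1 := two ((α * α) • p)
    have h2 := two ((α * α) • q)
    have h3 := two ((α * α) • (q * p))
    calc _ = -((α * α) • p + (α * α) • p) - ((α * α) • q + (α * α) • q)
        - ((α * α) • (q * p) + (α * α) • (q * p)) := by abel
      _ = 0 := by rw [h1, h2, h3]; simp
  · rintro ⟨s, hs, hx⟩
    have key (t : A) (ht : t * t = α • t) : IsIdempotentElem (α⁻¹ • t) := by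
      simp only [IsIdempotentElem, smul_mul_assoc, mul_smul_comm, ht, smul_smul]
      rw [inv_mul_cancel₀ hα, mul_one]
    -- Signs vanish, so `x + s` is `x - s`, the candidate for `αq`; the skew relation says exactly
    -- that its square is `α` times itself.
    refine ⟨α⁻¹ • s, α⁻¹ • (x + s), key s hs, key _ ?_, ?_⟩
    · rw [add_mul, mul_add, mul_add, hx, hs, smul_add]
      calc _ = (x * x + x * x) + (x * s + x * s) + (α • x + α • s) := by abel
        _ = _ := by rw [two, two]; simp
    · rw [smul_inv_smul₀ hα, smul_inv_smul₀ hα, add_left_comm, two, add_zero]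

end Composite

/-! ### Twisted derivations on cyclic modules -/

section Skew

variable {K : Type*} [Field K]

/-- A `K`-linear map satisfying the skew commutation relation with `X` behaves like a twisted
derivation with respect to all polynomials. -/
theorem skew_smul {M : Type*} [AddCommGroup M] [Module K M] [Module K[X] M]
    [IsScalarTower K K[X] M] {w : K[X]} {s : M →ₗ[K] M}
    (hs : ∀ m, s ((X : K[X]) • m) = (X : K[X]) • s m + w • m) (F : K[X]) (m : M) :
    s (F • m) = F • s m + (w * derivative F) • m := by
  have hC (a : K) (m : M) : C a • m = a • m := by
    rw [← algebraMap_eq, algebraMap_smul]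
  induction F using Polynomial.induction_on generalizing m with
  | C a => simp [hC]
  | add p q hp hq => simp only [add_smul, map_add, hp, hq, mul_add]; abel
  | monomial n a h =>
    rw [pow_succ, ← mul_assoc, mul_smul, h, hs, smul_add, derivative_mul (f := C a * X ^ n)]
    simp only [derivative_X, smul_smul, mul_one, mul_add, add_smul, ← add_assoc, mul_assoc]
    rw [mul_comm w (C a * X ^ n), mul_assoc]
    abel

/-- If `X` acts on a direct summand `K[X] ⧸ (P)` of a module with a skew-commuting map, then
`P` divides `w * P'`. -/
theorem dvd_mul_derivative_of_skew {M : Type*} [AddCommGroup M] [Module K M] {u s : M →ₗ[K] M}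
    {w P : K[X]} (hs : ∀ m, s (u m) = u (s m) + aeval u w m)
    (j : K[X] ⧸ Ideal.span {P} →ₗ[K] M) (r : M →ₗ[K] K[X] ⧸ Ideal.span {P})
    (hj : ∀ m, j ((X : K[X]) • m) = u (j m)) (hr : ∀ m, r (u m) = (X : K[X]) • r m)
    (hrj : ∀ m, r (j m) = m) : P ∣ w * derivative P := by
  have hrF (F : K[X]) (m : M) : r (aeval u F m) = F • r m := by
    induction F using Polynomial.induction_on generalizing m with
    | C a => rw [aeval_C, Module.algebraMap_end_apply, map_smul, ← algebraMap_eq, algebraMap_smul]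
    | add p q hp hq => simp [add_smul, hp, hq]
    | monomial n a h =>
      rw [pow_succ, ← mul_assoc, map_mul, Module.End.mul_apply, h, aeval_X, hr, mul_smul _ X]
  -- The compression `r s j` inherits the skew relation because `r` and `j` intertwine the actions.
  -- It is evaluated at `F = P` and the class of `1`, where both terms without `P'` vanish.
  have hskew := skew_smul (s := r ∘ₗ s ∘ₗ j) (w := w) (fun m => by
    simp only [LinearMap.comp_apply, hj, hs, map_add, hr, hrF, hrj]) P (Ideal.Quotient.mk _ 1)
  have hP (m : K[X] ⧸ Ideal.span {P}) : P • m = 0 := by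
    obtain ⟨f, rfl⟩ := Ideal.Quotient.mk_surjective m
    change Ideal.Quotient.mk _ (P * f) = 0
    rw [Ideal.Quotient.eq_zero_iff_mem]
    exact Ideal.mul_mem_right _ _ (Ideal.mem_span_singleton_self P)
  rw [hP, hP, map_zero, zero_add] at hskew
  have hmk : Ideal.Quotient.mk (Ideal.span {P}) (w * derivative P * 1) = 0 := hskew.symm
  rwa [Ideal.Quotient.eq_zero_iff_mem, Ideal.mem_span_singleton, mul_one] at hmk

/-- When `P` divides `X (X + α) P'`, the twisted derivation `α + X (X + α) d/dX` induces
an endomorphism of `K[X] ⧸ (P)`. -/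
theorem exists_skew_quotient [CharP K 2] (α : K) {P : K[X]}
    (hP : P ∣ X * (X + C α) * derivative P) :
    ∃ s : (K[X] ⧸ Ideal.span {P}) →ₗ[K] (K[X] ⧸ Ideal.span {P}), (∀ m, s (s m) = α • s m) ∧
      ∀ m, s ((X : K[X]) • m) = (X : K[X]) • s m + (X * (X + C α)) • m := by
  -- With `D = w d/dX`, one has `D² = w w' d/dX + w² d²/dX² = αD`, since `w' = α` and second
  -- derivatives vanish in characteristic two. Hence `(α + D)² = α² + αD = α(α + D)`.
  let s : K[X] →ₗ[K] K[X] :=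
    α • LinearMap.id + LinearMap.mulLeft K (X * (X + C α)) ∘ₗ derivative
  have s_apply (f : K[X]) : s f = C α * f + X * (X + C α) * derivative f := by
    simp [s, smul_eq_C_mul, mul_assoc]
  have hle : (Ideal.span {P}).restrictScalars K ≤
      ((Ideal.span {P}).restrictScalars K).comap s := by
    intro f hf
    simp only [Submodule.restrictScalars_mem, Submodule.mem_comap, Ideal.mem_span_singleton] at hf ⊢
    obtain ⟨g, rfl⟩ := hf
    rw [s_apply, derivative_mul]
    have : C α * (P * g) + X * (X + C α) * (derivative P * g + P * derivative g)
      = P * (C α * g + X * (X + C α) * derivative g) + X * (X + C α) * derivative P * g := by ring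
    rw [this]
    exact dvd_add (dvd_mul_right _ _) (hP.mul_right _)
  have h2 : (2 : K[X]) = 0 := CharTwo.two_eq_zero
  have hdd (f : K[X]) : derivative (derivative f) = 0 := by
    ext n
    rw [coeff_derivative, coeff_derivative, coeff_zero, mul_assoc]
    have : ((n + 1 : ℕ) + 1 : K) * (n + 1) = 0 := by
      have := (CharP.cast_eq_zero_iff K 2 ((n + 1 + 1) * (n + 1))).2
        (even_iff_two_dvd.1 (by rw [mul_comm]; exact Nat.even_mul_succ_self (n + 1)))
      exact_mod_cast this
    rw [this, mul_zero]
  refine ⟨((Ideal.span {P}).restrictScalars K).mapQ ((Ideal.span {P}).restrictScalars K) s hle,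
    ?_, ?_⟩
  · intro m
    obtain ⟨f, rfl⟩ := Ideal.Quotient.mk_surjective m
    change Ideal.Quotient.mk (Ideal.span {P}) (s (s f)) =
      Ideal.Quotient.mk (Ideal.span {P}) (α • s f)
    congr 1
    simp only [s_apply, derivative_mul, derivative_add, derivative_C, derivative_X, hdd,
      smul_eq_C_mul]
    linear_combination (C α * X * (X + C α) * derivative f + X ^ 2 * (X + C α) * derivative f) * h2
  · intro m
    obtain ⟨f, rfl⟩ := Ideal.Quotient.mk_surjective m
    change Ideal.Quotient.mk (Ideal.span {P}) (s (X * f)) =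
      Ideal.Quotient.mk (Ideal.span {P}) (X * s f + X * (X + C α) * f)
    congr 1
    simp only [s_apply, derivative_mul, derivative_X]
    ring

end Skew

/-! ### Existence of elementary factors -/

section CyclicProd

variable {K : Type*} [Field K]

/-- The product of the cyclic `K[X]`-modules `K[X] ⧸ (P)`, for `P` in the list `L`. -/
abbrev CyclicProd (L : List K[X]) : Type _ :=
  ∀ i : Fin L.length, K[X] ⧸ Ideal.span {L.get i}

/-- Splitting off the first factor of `CyclicProd`. -/
noncomputable def CyclicProd.cons (P : K[X]) (L : List K[X]) :
    ((K[X] ⧸ Ideal.span {P}) × CyclicProd L) ≃ₗ[K[X]] CyclicProd (P :: L) :=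
  Fin.consLinearEquiv K[X]
    (fun i : Fin (L.length + 1) => K[X] ⧸ Ideal.span {(P :: L).get i})

/-- The product of two cyclic modules is also the product of the cyclic modules attached to
the gcd and the lcm. -/
theorem exists_gcd_lcm_equiv {a b : K[X]} (ha : a.Monic) (hb : b.Monic) :
    ∃ g l : K[X], g.Monic ∧ l.Monic ∧ g ∣ a ∧ g ∣ b ∧ a ∣ l ∧ (∀ d, d ∣ a → d ∣ b → d ∣ g) ∧
      Nonempty (((K[X] ⧸ Ideal.span {a}) × (K[X] ⧸ Ideal.span {b})) ≃ₗ[K[X]]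
        ((K[X] ⧸ Ideal.span {g}) × (K[X] ⧸ Ideal.span {l}))) := by
  classical
  set g := normalize (EuclideanDomain.gcd a b) with hg
  have hgm : g.Monic := monic_normalize fun h => ha.ne_zero (EuclideanDomain.gcd_eq_zero_iff.1 h).1
  have hga : g ∣ a := normalize_dvd_iff.2 (EuclideanDomain.gcd_dvd_left a b)
  have hgb : g ∣ b := normalize_dvd_iff.2 (EuclideanDomain.gcd_dvd_right a b)
  have hgr (d : K[X]) (h1 : d ∣ a) (h2 : d ∣ b) : d ∣ g :=
    dvd_normalize_iff.2 (EuclideanDomain.dvd_gcd h1 h2)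
  have hbez : g ∈ Ideal.span {a, b} := by
    rw [← EuclideanDomain.span_gcd, Ideal.mem_span_singleton]
    exact dvd_normalize_iff.2 dvd_rfl
  obtain ⟨s, t, hst⟩ := Ideal.mem_span_pair.1 hbez
  obtain ⟨a', ha'⟩ := hga
  obtain ⟨b', hb'⟩ := hgb
  have hdet : s * a' + t * b' = 1 := by
    apply mul_left_cancel₀ hgm.ne_zero
    rw [mul_one]
    conv_rhs => rw [← hst]
    rw [mul_add]
    linear_combination -s * ha' - t * hb'
  have hb'm : b'.Monic := hgm.of_mul_monic_left (hb' ▸ hb)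
  refine ⟨g, a * b', hgm, ha.mul hb'm, ⟨a', ha'⟩, ⟨b', hb'⟩, dvd_mul_right _ _, hgr, ?_⟩
  let f₁ : K[X] × K[X] →ₗ[K[X]] ((K[X] ⧸ Ideal.span {a}) × (K[X] ⧸ Ideal.span {b})) :=
    LinearMap.prodMap (Submodule.mkQ _) (Submodule.mkQ _)
  -- The matrix with rows `(s, t)` and `(-b', a')` has determinant `1`. This change of basis turns
  -- the presentation by `a, b` into the one by `g` and `a * b'`, so both maps have the same kernel;
  -- the witnesses below come from the inverse matrix.
  let f₂ : K[X] × K[X] →ₗ[K[X]]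
      ((K[X] ⧸ Ideal.span {g}) × (K[X] ⧸ Ideal.span {a * b'})) :=
    LinearMap.prod
      (Submodule.mkQ _ ∘ₗ (s • LinearMap.fst K[X] K[X] K[X] + t • LinearMap.snd K[X] K[X] K[X]))
      (Submodule.mkQ _ ∘ₗ (a' • LinearMap.snd K[X] K[X] K[X] - b' • LinearMap.fst K[X] K[X] K[X]))
  have hf₁ : Function.Surjective f₁ :=
    Function.Surjective.prodMap (Submodule.mkQ_surjective _) (Submodule.mkQ_surjective _)
  have hf₂ : Function.Surjective f₂ := by
    rintro ⟨x, y⟩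
    obtain ⟨x, rfl⟩ := Submodule.mkQ_surjective _ x
    obtain ⟨y, rfl⟩ := Submodule.mkQ_surjective _ y
    refine ⟨(a' * x - t * y, b' * x + s * y), Prod.ext ?_ ?_⟩
    · change Submodule.mkQ _ (s * (a' * x - t * y) + t * (b' * x + s * y)) = Submodule.mkQ _ x
      congr 1
      linear_combination x * hdet
    · change Submodule.mkQ _ (a' * (b' * x + s * y) - b' * (a' * x - t * y)) = Submodule.mkQ _ y
      congr 1
      linear_combination y * hdet
  have hker : LinearMap.ker f₁ = LinearMap.ker f₂ := by
    ext ⟨x, y⟩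
    have h₁ : f₁ (x, y) = 0 ↔ a ∣ x ∧ b ∣ y := by
      simp [f₁, Ideal.Quotient.eq_zero_iff_mem, Ideal.mem_span_singleton]
    have h₂ : f₂ (x, y) = 0 ↔ g ∣ s * x + t * y ∧ a * b' ∣ a' * y - b' * x := by
      rw [Prod.ext_iff]
      change Submodule.mkQ _ (s * x + t * y) = 0 ∧ Submodule.mkQ _ (a' * y - b' * x) = 0 ↔ _
      simp only [Submodule.mkQ_apply, Submodule.Quotient.mk_eq_zero, Ideal.mem_span_singleton]
    rw [LinearMap.mem_ker, LinearMap.mem_ker, h₁, h₂]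
    constructor
    · rintro ⟨⟨x, rfl⟩, ⟨y, rfl⟩⟩
      refine ⟨⟨s * a' * x + t * b' * y, ?_⟩, ⟨y - x, ?_⟩⟩
      · linear_combination s * x * ha' + t * y * hb'
      · linear_combination a' * y * hb' - y * b' * ha'
    · rintro ⟨⟨z, hz⟩, ⟨v, hv⟩⟩
      refine ⟨⟨z - t * b' * v, ?_⟩, ⟨z + s * a' * v, ?_⟩⟩
      · linear_combination -x * hdet + a' * hz - t * hv - z * ha'
      · linear_combination -y * hdet + b' * hz + s * hv - z * hb' + s * v * b' * ha' -
          s * v * a' * hb'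
  exact ⟨(f₁.quotKerEquivOfSurjective hf₁).symm ≪≫ₗ Submodule.quotEquivOfEq _ _ hker ≪≫ₗ
    f₂.quotKerEquivOfSurjective hf₂⟩

/-- A cyclic factor can be inserted in a product of cyclic modules attached to a divisibility
chain. -/
theorem exists_chain_insert (L : List K[X]) : ∀ a : K[X], a.Monic → (∀ P ∈ L, P.Monic) →
    L.Pairwise (· ∣ ·) → ∃ L' : List K[X], (∀ P ∈ L', P.Monic) ∧ L'.Pairwise (· ∣ ·) ∧
      (∀ d, d ∣ a → (∀ P ∈ L, d ∣ P) → ∀ P ∈ L', d ∣ P) ∧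
      Nonempty (((K[X] ⧸ Ideal.span {a}) × CyclicProd L) ≃ₗ[K[X]] CyclicProd L') := by
  induction L with
  | nil =>
    intro a ha _ _
    exact ⟨[a], by simpa using ha, by simp, by simp +contextual, ⟨CyclicProd.cons a []⟩⟩
  | cons b L ih =>
    intro a ha hL hchain
    rw [List.forall_mem_cons] at hL
    rw [List.pairwise_cons] at hchain
    obtain ⟨g, l, hg, hl, hga, hgb, hal, hgr, ⟨e⟩⟩ := exists_gcd_lcm_equiv ha hL.1
    -- The gcd stays at the head and the lcm is inserted further along. The clause on common
    -- divisors ensures that the gcd still divides everything after it.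
    obtain ⟨L', hL', hchain', hdvd, ⟨e'⟩⟩ := ih l hl hL.2 hchain.2
    refine ⟨g :: L', List.forall_mem_cons.2 ⟨hg, hL'⟩, List.pairwise_cons.2 ⟨?_, hchain'⟩, ?_, ⟨?_⟩⟩
    · exact hdvd g (hga.trans hal) fun P hP => hgb.trans (hchain.1 P hP)
    · intro d hda hdL
      rw [List.forall_mem_cons] at hdL ⊢
      exact ⟨hgr d hda hdL.1, hdvd d (hda.trans hal) hdL.2⟩
    · exact ((LinearEquiv.refl _ _).prodCongr (CyclicProd.cons b L).symm) ≪≫ₗ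
        (LinearEquiv.prodAssoc K[X] _ _ _).symm ≪≫ₗ (e.prodCongr (LinearEquiv.refl _ _)) ≪≫ₗ
        LinearEquiv.prodAssoc K[X] _ _ _ ≪≫ₗ ((LinearEquiv.refl _ _).prodCongr e') ≪≫ₗ
        CyclicProd.cons g L'

/-- A finite product of cyclic torsion modules is attached to a divisibility chain. -/
theorem exists_chain_of_fin : ∀ (n : ℕ) (a : Fin n → K[X]), (∀ i, a i ≠ 0) →
    ∃ L : List K[X], (∀ P ∈ L, P.Monic) ∧ L.Pairwise (· ∣ ·) ∧
      Nonempty ((∀ i, K[X] ⧸ Ideal.span {a i}) ≃ₗ[K[X]] CyclicProd L)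
  | 0, _, _ => ⟨[], by simp, by simp, ⟨LinearEquiv.piCongrRight fun i => i.elim0⟩⟩
  | n + 1, a, ha => by
    classical
    obtain ⟨L, hL, hchain, ⟨e⟩⟩ := exists_chain_of_fin n (fun i => a i.succ) fun i => ha _
    obtain ⟨L', hL', hchain', -, ⟨e'⟩⟩ :=
      exists_chain_insert L (normalize (a 0)) (monic_normalize (ha 0)) hL hchain
    have hspan : Ideal.span {a 0} = Ideal.span {normalize (a 0)} :=
      Ideal.span_singleton_eq_span_singleton.2 (normalize_associated (a 0)).symm
    exact ⟨L', hL', hchain', ⟨(Fin.consLinearEquiv K[X] fun i => K[X] ⧸ Ideal.span {a i}).symm ≪≫ₗ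
      (Submodule.quotEquivOfEq _ _ hspan).prodCongr e ≪≫ₗ e'⟩⟩

/-- The trivial factors of a product of cyclic modules can be dropped. -/
theorem exists_sublist_nonconstant (L : List K[X]) (hL : ∀ P ∈ L, P.Monic) :
    ∃ L' : List K[X], L'.Sublist L ∧ (∀ P ∈ L', 0 < P.natDegree) ∧
      Nonempty (CyclicProd L ≃ₗ[K[X]] CyclicProd L') := by
  induction L with
  | nil => exact ⟨[], List.Sublist.refl _, by simp, ⟨LinearEquiv.refl _ _⟩⟩
  | cons P L ih =>
    rw [List.forall_mem_cons] at hL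
    obtain ⟨L', hsub, hpos, ⟨e⟩⟩ := ih hL.2
    by_cases hP : P.natDegree = 0
    · have : Subsingleton (K[X] ⧸ Ideal.span {P}) := by
        rw [hL.1.natDegree_eq_zero.1 hP, Ideal.span_singleton_one]
        exact Ideal.Quotient.subsingleton_iff.2 rfl
      have : Unique (K[X] ⧸ Ideal.span {P}) := Unique.mk' _
      exact ⟨L', hsub.cons P, hpos, ⟨(CyclicProd.cons P L).symm ≪≫ₗ
        LinearEquiv.uniqueProd ≪≫ₗ e⟩⟩
    · exact ⟨P :: L', hsub.cons_cons P, List.forall_mem_cons.2 ⟨Nat.pos_of_ne_zero hP, hpos⟩,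
        ⟨(CyclicProd.cons P L).symm ≪≫ₗ (LinearEquiv.refl _ _).prodCongr e ≪≫ₗ
          CyclicProd.cons P L'⟩⟩

/-- Every endomorphism of a finite-dimensional space has a list of elementary factors. -/
theorem exists_isElementaryFactors {E : Type*} [AddCommGroup E] [Module K E]
    [FiniteDimensional K E] (v : Module.End K E) : ∃ L : List K[X], IsElementaryFactors v L := by
  classical
  have htors : Module.IsTorsion K[X] (Module.AEval' v) :=
    Module.AEval.isTorsion_of_finiteDimensional K E v
  obtain ⟨ι, _, p, hp, e, ⟨φ⟩⟩ := Module.equiv_directSum_of_isTorsion htors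
  let σ := (Fintype.equivFin ι).symm
  obtain ⟨L, hL, hchain, ⟨ψ⟩⟩ := exists_chain_of_fin _ (fun i => p (σ i) ^ e (σ i))
    fun i => pow_ne_zero _ (hp _).ne_zero
  obtain ⟨L', hsub, hpos, ⟨χ⟩⟩ := exists_sublist_nonconstant L hL
  exact ⟨L', fun P hP => ⟨hL P (hsub.subset hP), hpos P hP⟩, (hchain.sublist hsub).isChain,
    ⟨φ ≪≫ₗ DirectSum.linearEquivFunOnFintype K[X] ι _ ≪≫ₗ
      (LinearEquiv.piCongrLeft K[X] (fun i => K[X] ⧸ Ideal.span {p i ^ e i}) σ).symm ≪≫ₗ ψ ≪≫ₗ χ⟩⟩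

end CyclicProd

/-! ### Divisibility criterion and the two factors of the minimal polynomial -/

section Summands

variable {K : Type*} [Field K]

/-- An endomorphism is a composite when the divisors in a cyclic decomposition of its
`K[X]`-module satisfy the differential divisibility condition. -/
theorem isComposite_of_dvd_derivative [CharP K 2] {α : K} (hα : α ≠ 0)
    {E : Type*} [AddCommGroup E] [Module K E] {v : Module.End K E} {L : List K[X]}
    (hL : ∀ P ∈ L, P ∣ X * (X + C α) * derivative P)
    (e : Module.AEval' v ≃ₗ[K[X]] CyclicProd L) : IsComposite α α v := by
  choose s hss hsX using fun i : Fin L.length => exists_skew_quotient α (hL _ (L.get_mem i))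
  let S : CyclicProd L →ₗ[K] CyclicProd L := LinearMap.pi fun i => s i ∘ₗ LinearMap.proj i
  let ε : E ≃ₗ[K] CyclicProd L := (Module.AEval'.of v) ≪≫ₗ e.restrictScalars K
  have hε (x : E) : ε (v x) = (X : K[X]) • ε x := by
    change e (Module.AEval'.of v (v x)) = X • e (Module.AEval'.of v x)
    rw [← map_smul, Module.AEval.X_smul_of]
    rfl
  rw [isComposite_iff_exists_skew hα]
  refine ⟨ε.symm.toLinearMap ∘ₗ S ∘ₗ ε.toLinearMap, ?_, ?_⟩
  · ext x
    apply ε.injective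
    simp only [Module.End.mul_apply, LinearMap.comp_apply, LinearEquiv.coe_coe,
      LinearEquiv.apply_symm_apply, LinearMap.smul_apply, map_smul]
    exact funext fun i => hss i _
  · ext x
    apply ε.injective
    simp only [Module.End.mul_apply, LinearMap.comp_apply, LinearEquiv.coe_coe,
      LinearEquiv.apply_symm_apply, LinearMap.smul_apply, LinearMap.add_apply, map_smul, map_add,
      hε]
    funext i
    refine (hsX i _).trans ?_
    change (X : K[X]) • s i (ε x i) + (X * (X + C α)) • ε x i =
      (X : K[X]) • s i (ε x i) + ((X : K[X]) • (X : K[X]) • ε x i + α • (X : K[X]) • ε x i)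
    rw [mul_comm X, mul_smul, add_smul, ← algebraMap_eq, algebraMap_smul]

/-- The divisors in a cyclic decomposition of a direct summand of a composite satisfy the
differential divisibility condition. -/
theorem dvd_derivative_of_isComposite_prodMap [CharP K 2] {α : K} (hα : α ≠ 0)
    {A B : Type*} [AddCommGroup A] [Module K A] [AddCommGroup B] [Module K B]
    {a : Module.End K A} {b : Module.End K B} (h : IsComposite α α (a.prodMap b : Module.End K _))
    {L : List K[X]} (e : Module.AEval' b ≃ₗ[K[X]] CyclicProd L) :
    ∀ P ∈ L, P ∣ X * (X + C α) * derivative P := by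
  intro P hP
  obtain ⟨i, rfl⟩ := List.get_of_mem hP
  obtain ⟨s, -, hs⟩ := (isComposite_iff_exists_skew hα).1 h
  let ε : B ≃ₗ[K] CyclicProd L := (Module.AEval'.of b) ≪≫ₗ e.restrictScalars K
  have hε (x : B) : ε (b x) = (X : K[X]) • ε x := by
    change e (Module.AEval'.of b (b x)) = X • e (Module.AEval'.of b x)
    rw [← map_smul, Module.AEval.X_smul_of]
    rfl
  have hε' (x : CyclicProd L) : ε.symm ((X : K[X]) • x) = b (ε.symm x) := by
    rw [LinearEquiv.symm_apply_eq, hε, LinearEquiv.apply_symm_apply]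
  -- The operator `s` need not preserve `A` or `B`; only its compression to the `i`-th cyclic factor
  -- of `B` is used.
  refine dvd_mul_derivative_of_skew (u := a.prodMap b) (s := s) ?_
    (LinearMap.inr K A B ∘ₗ ε.symm.toLinearMap ∘ₗ
      LinearMap.single K (fun i : Fin L.length => K[X] ⧸ Ideal.span {L.get i}) i)
    (LinearMap.proj i ∘ₗ ε.toLinearMap ∘ₗ LinearMap.snd K A B) ?_ ?_ ?_
  · intro m
    have := LinearMap.congr_fun hs m
    simpa [mul_add, Module.End.mul_apply, mul_comm X, ← algebraMap_eq] using this
  · intro m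
    have : (Pi.single i ((X : K[X]) • m) : CyclicProd L) = (X : K[X]) • Pi.single i m :=
      Pi.single_smul i _ _
    simp [this, hε']
  · intro m
    simp [hε]
  · intro m
    simp

/-- The differential divisibility condition holds for products of linear factors whose roots
are roots of `w`. -/
theorem dvd_mul_derivative_of_roots {w : K[X]} (s : Multiset K) (hs : ∀ a ∈ s, X - C a ∣ w) :
    (s.map fun a => X - C a).prod ∣ w * derivative (s.map fun a => X - C a).prod := by
  induction s using Multiset.induction_on with
  | empty => simp
  | cons a s ih =>
    rw [Multiset.map_cons, Multiset.prod_cons, derivative_mul, mul_add]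
    refine dvd_add ?_ ?_
    · rw [derivative_sub, derivative_X, derivative_C, sub_zero, one_mul]
      exact mul_dvd_mul_right (hs a (Multiset.mem_cons_self a s)) _
    · rw [mul_left_comm]
      exact mul_dvd_mul_left _ (ih fun b hb => hs b (Multiset.mem_cons_of_mem hb))

/-- In characteristic two, a polynomial with zero derivative is even, and conversely. -/
theorem isEvenPoly_iff_derivative_eq_zero [CharP K 2] {P : K[X]} :
    IsEvenPoly P ↔ derivative P = 0 := by
  constructor
  · rintro ⟨Q, rfl⟩
    rw [derivative_comp, derivative_X_pow, Nat.cast_ofNat, CharTwo.two_eq_zero, C_0]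
    simp
  · intro h
    -- A zero derivative kills the odd coefficients, so `contract 2 P`, built from the even ones,
    -- loses nothing.
    exact ⟨contract 2 P, by rw [← expand_eq_comp_X_pow, expand_contract 2 h two_ne_zero]⟩

/-- A polynomial annihilating an endomorphism is a multiple of all the divisors in a cyclic
decomposition. -/
theorem dvd_of_aeval_eq_zero {E : Type*} [AddCommGroup E] [Module K E] {v : Module.End K E}
    {L : List K[X]} (e : Module.AEval' v ≃ₗ[K[X]] CyclicProd L) {F : K[X]} (hF : aeval v F = 0) :
    ∀ P ∈ L, P ∣ F := by
  intro P hP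
  obtain ⟨i, rfl⟩ := List.get_of_mem hP
  have h (x : CyclicProd L) : F • x = 0 := by
    rw [← e.apply_symm_apply x, ← map_smul]
    have : F • e.symm x = 0 := (Module.AEval'.of v).symm.injective (by
      rw [Module.AEval.of_symm_smul, hF, zero_smul, map_zero])
    rw [this, map_zero]
  have h1 : Ideal.Quotient.mk (Ideal.span {L.get i}) (F * 1) = 0 :=
    congrFun (h fun _ => Ideal.Quotient.mk _ 1) i
  rwa [mul_one, Ideal.Quotient.eq_zero_iff_mem, Ideal.mem_span_singleton] at h1

/-- The restriction of `u` to the kernel of `F(u)` is annihilated by `F`. -/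
theorem aeval_restrict_ker_eq_zero {E : Type*} [AddCommGroup E] [Module K E] (u : Module.End K E)
    (F : K[X]) (h : ∀ x ∈ LinearMap.ker (aeval u F), u x ∈ LinearMap.ker (aeval u F)) :
    aeval (u.restrict h : Module.End K _) F = 0 := by
  have key (G : K[X]) (x : LinearMap.ker (aeval u F)) :
      ((aeval (u.restrict h : Module.End K _) G x : LinearMap.ker (aeval u F)) : E)
        = aeval u G x := by
    induction G using Polynomial.induction_on generalizing x with
    | C a => simp [Module.algebraMap_end_apply]
    | add p q hp hq => simp [hp, hq]
    | monomial n a h =>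
      rw [pow_succ, ← mul_assoc, map_mul (aeval (u.restrict _)), map_mul (aeval u) (_ * _),
        Module.End.mul_apply, Module.End.mul_apply, h, aeval_X, aeval_X]
      rfl
  ext x
  rw [key]
  exact x.2

/-- A product of linear factors is coprime to every polynomial having none of their roots. -/
theorem isCoprime_prod_X_sub_C {Q : K[X]} (s : Multiset K) (hs : ∀ a ∈ s, ¬ Q.IsRoot a) :
    IsCoprime (s.map fun a => X - C a).prod Q := by
  induction s using Multiset.induction_on with
  | empty => simpa using isCoprime_one_left
  | cons a s ih =>
    rw [Multiset.map_cons, Multiset.prod_cons]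
    refine IsCoprime.mul_left ?_ (ih fun b hb => hs b (Multiset.mem_cons_of_mem hb))
    rw [(irreducible_X_sub_C a).coprime_iff_not_dvd, dvd_iff_isRoot]
    exact hs a (Multiset.mem_cons_self a s)

/-- The kernel of `F(u)` is stable under `u`. -/
theorem ker_aeval_invariant {E : Type*} [AddCommGroup E] [Module K E] (u : Module.End K E)
    (F : K[X]) : ∀ x ∈ LinearMap.ker (aeval u F), u x ∈ LinearMap.ker (aeval u F) := by
  intro x hx
  have hc : aeval u F * u = u * aeval u F := by
    simpa only [map_mul, aeval_X] using congrArg (aeval u) (mul_comm F X)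
  have h := LinearMap.congr_fun hc x
  rw [LinearMap.mem_ker] at hx ⊢
  simpa [Module.End.mul_apply, hx] using h

/-- The roots of `insidePoly u Λ` lie in `Λ`. -/
theorem mem_of_isRoot_insidePoly {E : Type*} [AddCommGroup E] [Module K E]
    {u : Module.End K E} {Λ : Set K} {a : K} (h : (insidePoly u Λ).IsRoot a) : a ∈ Λ := by
  classical
  rw [← mem_roots (insidePoly_monic u Λ).ne_zero, insidePoly, roots_multiset_prod_X_sub_C] at h
  exact (Multiset.mem_filter.1 h).2

/-- The two factors of the minimal polynomial are coprime. -/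
theorem isCoprime_insidePoly_outsidePoly {E : Type*} [AddCommGroup E] [Module K E]
    [FiniteDimensional K E] (u : Module.End K E) (Λ : Set K) :
    IsCoprime (insidePoly u Λ) (outsidePoly u Λ) := by
  classical
  refine isCoprime_prod_X_sub_C _ fun a ha => ?_
  exact outsidePoly_not_isRoot u Λ a (Multiset.mem_filter.1 ha).2

end Summands

/-! ### Primary splitting of `u` and conclusion -/

theorem theorem6 {K : Type*} [Field K] [CharP K 2]
    {E : Type*} [AddCommGroup E] [Module K E] [FiniteDimensional K E]
    (α : K) (hα : α ≠ 0) (u : Module.End K E) :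
    (IsComposite α (-α) u ↔ IsComposite α α u) ∧
    (∃ L : List K[X], IsElementaryFactors (outsidePart u {0, α}) L) ∧
    (∀ L : List K[X], IsElementaryFactors (outsidePart u {0, α}) L →
      (IsComposite α (-α) u ↔ ∀ P ∈ L, IsEvenPoly P)) := by
  rw [CharTwo.neg_eq]
  refine ⟨Iff.rfl, exists_isElementaryFactors _, ?_⟩
  rintro L ⟨-, -, ⟨e⟩⟩
  set Λ : Set K := {0, α} with hΛ
  have hw (a : K) (ha : a ∈ Λ) : X - C a ∣ X * (X + C α) := by
    rcases ha with rfl | rfl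
    · simp
    · rw [CharTwo.sub_eq_add]
      exact dvd_mul_left _ _
  have hcop := isCoprime_insidePoly_outsidePoly u Λ
  have hcompl : IsCompl (LinearMap.ker (aeval u (insidePoly u Λ))) (outsideSpace u Λ) := by
    refine ⟨disjoint_ker_aeval_of_isCoprime u hcop, codisjoint_iff.2 ?_⟩
    rw [outsideSpace, sup_ker_aeval_eq_ker_aeval_mul_of_coprime u hcop,
      insidePoly_mul_outsidePoly, minpoly.aeval, LinearMap.ker_zero]
  let v : Module.End K (LinearMap.ker (aeval u (insidePoly u Λ))) :=
    u.restrict (ker_aeval_invariant u _)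
  let Φ := Submodule.prodEquivOfIsCompl _ _ hcompl
  have hΦ : Φ.conjAlgEquiv K (v.prodMap (outsidePart u Λ)) = u := by
    ext x
    obtain ⟨y, rfl⟩ := Φ.surjective x
    simp [Φ, v, outsidePart, LinearEquiv.conjAlgEquiv_apply]
  constructor
  · intro hu P hP
    have hpair : IsComposite α α (v.prodMap (outsidePart u Λ) : Module.End K _) := by
      rw [← (Φ.conjAlgEquiv K).symm_apply_apply (v.prodMap (outsidePart u Λ)), hΦ]
      exact hu.map (Φ.conjAlgEquiv K).symm.toAlgHom
    have hdvd := dvd_derivative_of_isComposite_prodMap hα hpair e P hP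
    have hPQ : P ∣ outsidePoly u Λ :=
      dvd_of_aeval_eq_zero e (aeval_restrict_ker_eq_zero u _ _) P hP
    -- `P` divides `outsidePoly u Λ`, which has no root in `{0, α}`.
    have hPw : IsCoprime P (X * (X + C α)) := by
      have h := isCoprime_prod_X_sub_C (Q := outsidePoly u Λ) {0, α} (by
        intro a ha
        exact outsidePoly_not_isRoot u Λ a (by simpa [hΛ] using ha))
      have hprod : (Multiset.map (fun a : K => X - C a) {0, α}).prod = X * (X + C α) := by
        rw [← CharTwo.sub_eq_add]
        simp
      rw [hprod] at h
      exact h.symm.of_isCoprime_of_dvd_left hPQ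
    rw [isEvenPoly_iff_derivative_eq_zero]
    by_contra hne
    have hPd : P ∣ derivative P := hPw.dvd_of_dvd_mul_left hdvd
    exact (degree_derivative_lt fun h0 => hne (by rw [h0, derivative_zero])).not_ge
      (degree_le_of_dvd hPd hne)
  · intro hL
    obtain ⟨L₀, hL₀, -, ⟨e₀⟩⟩ := exists_isElementaryFactors v
    have hv : IsComposite α α v := by
      refine isComposite_of_dvd_derivative hα (fun P hP => ?_) e₀
      have hdvd : P ∣ insidePoly u Λ :=
        dvd_of_aeval_eq_zero e₀ (aeval_restrict_ker_eq_zero u _ _) P hP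
      -- As a divisor of `insidePoly u Λ`, `P` is a product of linear factors with roots in `{0,
      -- α}`, each of which divides `w`.
      have hsplit : P.Splits := by
        refine Splits.of_dvd (Splits.multisetProd fun f hf => ?_) (insidePoly_monic u Λ).ne_zero hdvd
        obtain ⟨a, -, rfl⟩ := Multiset.mem_map.1 hf
        exact Splits.X_sub_C a
      rw [hsplit.eq_prod_roots_of_monic (hL₀ P hP).1]
      refine dvd_mul_derivative_of_roots _ fun a ha => hw a ?_
      exact mem_of_isRoot_insidePoly ((isRoot_of_mem_roots ha).dvd hdvd)
    have hout : IsComposite α α (outsidePart u Λ) := by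
      refine isComposite_of_dvd_derivative hα (fun P hP => ?_) e
      rw [isEvenPoly_iff_derivative_eq_zero.1 (hL P hP), mul_zero]
      exact dvd_zero P
    have := ((hv.prodMk hout).map (LinearMap.prodMapAlgHom K _ _)).map (Φ.conjAlgEquiv K).toAlgHom
    rw [← hΦ]
    exact this
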